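/- Theorem (Consistent Invariant Variable Selection for Transfer Lasso). Fix $p\in\mathbb{N}$, $\beta^*\in\mathbb{R}^p$ and $\sigma\ge 0$, and let $S=\{j:\beta^*_j\neq 0\}$. For each $n$ let $y=X\beta^*+\varepsilon\in\mathbb{R}^n$, where $X=X_n\in\mathbb{R}^{n\times p}$ is a deterministic design matrix with rows $x_1,\dots,x_n$ and $\varepsilon=\varepsilon^{(n)}$ has i.i.d. $\mathcal{N}(0,\sigma^2)$ components. Assume that, as $n\to\infty$, $$\frac1n X^\top X\to C \text{ with } C \text{ positive definite},\qquad \frac1n\max_{i}\|x_i\|_2^2\to 0 .$$ Let $m=m_n$ be integers, positive for all large $n$, with $n/m\to r_0$ for some $r_0\in[0,\infty)$. Let $\tilde\beta=\tilde\beta_n$ be a random vector in $\mathbb{R}^p$ (the initial estimator), independent of $\varepsilon^{(n)}$, such that $\sqrt m(\tilde\beta-\beta^*)$ converges in distribution to some probability law on $\mathbb{R}^p$ (in particular $\tilde\beta$ is $\sqrt m$-consistent). Suppose that $\tilde\beta$ is inconsistent with respect to active variable selection: there is a constant $c<1$ with $$\limsup_{n\to\infty}P\big(\{j:\tilde\beta_j\ne0\}=S\big)\le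 c .$$ Let $\hat\beta_n^{\mathcal T}$ be the Transfer Lasso estimator, i.e. any minimizer over $\beta\in\mathbb{R}^p$ of $$\frac1n\|y-X\beta\|_2^2+\frac{\lambda_n}{n}\sum_{j}|\beta_j|+\frac{\eta_n}{n}\sum_j|\beta_j-\tilde\beta_j| .$$ If $\eta_n/\sqrt n\to\infty$ and $\lambda_n/\eta_n\to\rho_0$ with $0\le\rho_0<1$, then the Transfer Lasso yields consistent invariant variable selection, that is, $$P\big(\hat\beta^{\mathcal T}_{n,j}=\tilde\beta_j\ \text{ for all } j\in S\big)\to 1\qquad(n\to\infty).$$ -/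

import Mathlib

/-!
`n` times the objective grows from `βinit` at least at the rate
`eta - |lam| - 2 ‖Xᵀ (y - X βinit)‖_∞` in the `ℓ¹` distance to `βinit`, so `βinit` is the unique
minimizer once this rate is positive. In the linear model the score `Xᵀ (y - X βinit)` is
`Xᵀ ε - n C_n (βinit - β*)`, and both terms are `O_P(√n)`: the first by Chebyshev's inequality, the
second because `n / m` is bounded. The penalty gap `eta - |lam|` has larger order than `√n`, so the
whole vector `βhat` equals `βinit` with probability tending to one, not only its active coordinates.
-/

open MeasureTheory ProbabilityTheory Filter Topology
open scoped Matrix NNReal ENNReal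

/-- The active set `S = {j : β j ≠ 0}` of a coefficient vector. -/
def activeSet {p : ℕ} (β : Fin p → ℝ) : Set (Fin p) := {j | β j ≠ 0}

/-- The response `y = X β* + ε` of the linear model. -/
noncomputable def linearResponse {n p : ℕ} (X : Matrix (Fin n) (Fin p) ℝ) (βstar : Fin p → ℝ)
    (ε : Fin n → ℝ) : Fin n → ℝ :=
  X *ᵥ βstar + ε

/-- The Gram matrix `C_n = (1/n) Xᵀ X`. -/
noncomputable def gramMatrix {n p : ℕ} (X : Matrix (Fin n) (Fin p) ℝ) :
    Matrix (Fin p) (Fin p) ℝ :=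
  (1 / (n : ℝ)) • (Xᵀ * X)

/-- The normalized largest squared row norm `(1/n) max_i ‖x_i‖₂²`
(a maximum over finitely many rows). -/
noncomputable def maxRowSqNorm {n p : ℕ} (X : Matrix (Fin n) (Fin p) ℝ) : ℝ :=
  (1 / (n : ℝ)) * ⨆ i : Fin n, ∑ j : Fin p, X i j ^ 2

/-- The Transfer Lasso objective
`(1/n) ‖y - X β‖₂² + (lam/n) ∑ |β_j| + (eta/n) ∑ |β_j - βinit_j|`. -/
noncomputable def transferLassoObjective {n p : ℕ} (X : Matrix (Fin n) (Fin p) ℝ)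
    (y : Fin n → ℝ) (βinit : Fin p → ℝ) (lam eta : ℝ) (β : Fin p → ℝ) : ℝ :=
  (1 / (n : ℝ)) * ∑ i : Fin n, (y i - (X *ᵥ β) i) ^ 2
    + (lam / n) * ∑ j : Fin p, |β j|
    + (eta / n) * ∑ j : Fin p, |β j - βinit j|

/-- `βhat` is a Transfer Lasso solution: a global minimizer of the objective. -/
def IsTransferLasso {n p : ℕ} (X : Matrix (Fin n) (Fin p) ℝ) (y : Fin n → ℝ)
    (βinit : Fin p → ℝ) (lam eta : ℝ) (βhat : Fin p → ℝ) : Prop :=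
  IsMinOn (transferLassoObjective X y βinit lam eta) Set.univ βhat

/-- Inconsistent active variable selection of a sequence of estimators `b`:
`limsup P(Ŝ_n = S) ≤ c < 1` for a constant `c`. -/
def InconsistentActiveSelection {Ω : Type*} [MeasurableSpace Ω] (P : Measure Ω) {p : ℕ}
    (βstar : Fin p → ℝ) (b : ℕ → Ω → Fin p → ℝ) : Prop :=
  ∃ c : ℝ≥0∞, c < 1 ∧
    limsup (fun n => P {ω | activeSet (b n ω) = activeSet βstar}) atTop ≤ c

/-- Consistent invariant variable selection: `P(βhat_S = βinit_S) → 1`. -/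
def ConsistentInvariantSelection {Ω : Type*} [MeasurableSpace Ω] (P : Measure Ω) {p : ℕ}
    (βstar : Fin p → ℝ) (βinit βhat : ℕ → Ω → Fin p → ℝ) : Prop :=
  Tendsto (fun n => P {ω | ∀ j ∈ activeSet βstar, βhat n ω j = βinit n ω j}) atTop (𝓝 1)

theorem abs_dotProduct_le_norm_mul_sum_abs {ι : Type*} [Fintype ι] (u v : ι → ℝ) :
    |u ⬝ᵥ v| ≤ ‖u‖ * ∑ i, |v i| := by
  rw [dotProduct, Finset.mul_sum]
  refine (Finset.abs_sum_le_sum_abs _ _).trans (Finset.sum_le_sum fun i _ => ?_)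
  rw [abs_mul]
  exact mul_le_mul_of_nonneg_right (norm_le_pi_norm u i) (abs_nonneg _)

theorem mul_sum_abs_sub_le {ι : Type*} [Fintype ι] (c : ℝ) (u v : ι → ℝ) :
    c * ∑ i, |u i| - c * ∑ i, |v i| ≤ |c| * ∑ i, |v i - u i| := by
  simp only [Finset.mul_sum, ← Finset.sum_sub_distrib, ← mul_sub]
  refine Finset.sum_le_sum fun i _ => (le_abs_self _).trans ?_
  rw [abs_mul, abs_sub_comm (v i)]
  exact mul_le_mul_of_nonneg_left (abs_abs_sub_abs_le_abs_sub _ _) (abs_nonneg c)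

section DeterministicBound

variable {n p : ℕ}

theorem sum_sq_residual_le (X : Matrix (Fin n) (Fin p) ℝ) (y : Fin n → ℝ) (b β : Fin p → ℝ) :
    ∑ i, (y i - (X *ᵥ b) i) ^ 2 - 2 * ((Xᵀ *ᵥ (y - X *ᵥ b)) ⬝ᵥ (β - b))
      ≤ ∑ i, (y i - (X *ᵥ β) i) ^ 2 := by
  have hcross : (Xᵀ *ᵥ (y - X *ᵥ b)) ⬝ᵥ (β - b)
      = ∑ i, (y i - (X *ᵥ b) i) * ((X *ᵥ β) i - (X *ᵥ b) i) := by
    rw [Matrix.mulVec_transpose, ← Matrix.dotProduct_mulVec, Matrix.mulVec_sub]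
    rfl
  rw [hcross, Finset.mul_sum, ← Finset.sum_sub_distrib]
  refine Finset.sum_le_sum fun i _ => ?_
  linarith [sq_nonneg ((X *ᵥ β) i - (X *ᵥ b) i)]

theorem transferLassoObjective_init_add_le (X : Matrix (Fin n) (Fin p) ℝ) (y : Fin n → ℝ)
    (b : Fin p → ℝ) (lam eta : ℝ) (β : Fin p → ℝ) :
    transferLassoObjective X y b lam eta b
        + 1 / n * ((eta - |lam| - 2 * ‖Xᵀ *ᵥ (y - X *ᵥ b)‖) * ∑ j, |β j - b j|)
      ≤ transferLassoObjective X y b lam eta β := by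
  have hfit := sum_sq_residual_le X y b β
  have hscore := (le_abs_self _).trans
    (abs_dotProduct_le_norm_mul_sum_abs (Xᵀ *ᵥ (y - X *ᵥ b)) (β - b))
  have hpenalty := mul_sum_abs_sub_le lam b β
  simp only [Pi.sub_apply] at hscore
  have hscaled : ∑ i, (y i - (X *ᵥ b) i) ^ 2 + lam * ∑ j, |b j|
        + (eta - |lam| - 2 * ‖Xᵀ *ᵥ (y - X *ᵥ b)‖) * ∑ j, |β j - b j|
      ≤ ∑ i, (y i - (X *ᵥ β) i) ^ 2 + lam * ∑ j, |β j| + eta * ∑ j, |β j - b j| := by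
    linarith
  have hobjective := mul_le_mul_of_nonneg_left hscaled (one_div_nonneg.mpr n.cast_nonneg)
  simp only [transferLassoObjective, sub_self, abs_zero, Finset.sum_const_zero]
  linear_combination hobjective

theorem IsTransferLasso.eq_init_of_norm_score_lt {X : Matrix (Fin n) (Fin p) ℝ} {y : Fin n → ℝ}
    {b βhat : Fin p → ℝ} {lam eta : ℝ} (h : IsTransferLasso X y b lam eta βhat)
    (hn : 0 < n) (hscore : 2 * ‖Xᵀ *ᵥ (y - X *ᵥ b)‖ < eta - |lam|) : βhat = b := by
  have hgrowth : 1 / (n : ℝ) *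
      ((eta - |lam| - 2 * ‖Xᵀ *ᵥ (y - X *ᵥ b)‖) * ∑ j, |βhat j - b j|) ≤ 0 := by
    have hmin : transferLassoObjective X y b lam eta βhat
        ≤ transferLassoObjective X y b lam eta b := h (Set.mem_univ b)
    linarith [transferLassoObjective_init_add_le X y b lam eta βhat]
  have hdist : ∑ j, |βhat j - b j| ≤ 0 :=
    nonpos_of_mul_nonpos_right (nonpos_of_mul_nonpos_right hgrowth (by positivity))
      (sub_pos.mpr hscore)
  have hcoord := (Finset.sum_eq_zero_iff_of_nonneg fun j _ => abs_nonneg (βhat j - b j)).mp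
    (hdist.antisymm (Finset.sum_nonneg fun j _ => abs_nonneg _))
  exact funext fun j => sub_eq_zero.mp (abs_eq_zero.mp (hcoord j (Finset.mem_univ j)))

theorem transpose_mulVec_linearResponse_sub (X : Matrix (Fin n) (Fin p) ℝ)
    (βstar b : Fin p → ℝ) (ε : Fin n → ℝ) :
    Xᵀ *ᵥ (linearResponse X βstar ε - X *ᵥ b)
      = Xᵀ *ᵥ ε - (n : ℝ) • (gramMatrix X *ᵥ (b - βstar)) := by
  have hgram : (n : ℝ) • gramMatrix X = Xᵀ * X := by
    rcases n.eq_zero_or_pos with rfl | hn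
    · ext; simp [Matrix.mul_apply]
    · rw [gramMatrix, smul_smul, mul_one_div_cancel (by positivity), one_smul]
  rw [← Matrix.smul_mulVec, hgram, ← Matrix.mulVec_mulVec, ← Matrix.mulVec_sub, linearResponse,
    Matrix.mulVec_sub X b βstar]
  congr 1
  abel

theorem sum_sq_eq_mul_gramMatrix_apply_self (X : Matrix (Fin n) (Fin p) ℝ) (j : Fin p) :
    ∑ i, X i j ^ 2 = n * gramMatrix X j j := by
  rcases n.eq_zero_or_pos with rfl | hn
  · simp
  · simp only [gramMatrix, Matrix.smul_apply, Matrix.mul_apply, Matrix.transpose_apply,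
      smul_eq_mul, ← pow_two]
    field_simp

end DeterministicBound

section BoundedInProbability

variable {Ω E : Type*} [MeasurableSpace Ω] {P : Measure Ω} [SeminormedAddCommGroup E]

/-- A sequence of random vectors is `O_P(1)` if it exceeds every diverging sequence of thresholds
with vanishing probability; for sequences this is the same as asymptotic tightness. The sets
`{T n ≤ ‖Y n‖}` are not required to be measurable. -/
def IsBoundedInProbability (P : Measure Ω) (Y : ℕ → Ω → E) : Prop :=
  ∀ T : ℕ → ℝ, Tendsto T atTop atTop → Tendsto (fun n => P {ω | T n ≤ ‖Y n ω‖}) atTop (𝓝 0)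

namespace IsBoundedInProbability

theorem of_norm_le_mul {F : Type*} [SeminormedAddCommGroup F] {Y : ℕ → Ω → E} {Z : ℕ → Ω → F}
    (hY : IsBoundedInProbability P Y) {K : ℕ → ℝ} (hK : K =O[atTop] fun _ => (1 : ℝ))
    (hZ : ∀ᶠ n in atTop, ∀ ω, ‖Z n ω‖ ≤ K n * ‖Y n ω‖) : IsBoundedInProbability P Z := by
  intro T hT
  obtain ⟨c, hc, hKc⟩ := hK.exists_pos
  refine tendsto_of_tendsto_of_tendsto_of_le_of_le' tendsto_const_nhds
    (hY _ (hT.atTop_div_const hc)) (Eventually.of_forall fun _ => zero_le) ?_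
  filter_upwards [hZ, hKc.bound] with n hZn hKn
  refine measure_mono fun ω (hω : T n ≤ ‖Z n ω‖) => (div_le_iff₀' hc).mpr ?_
  have hKle : K n ≤ c := by simpa using (le_abs_self _).trans hKn
  exact hω.trans ((hZn ω).trans (mul_le_mul_of_nonneg_right hKle (norm_nonneg _)))

theorem sub {Y Z : ℕ → Ω → E} (hY : IsBoundedInProbability P Y)
    (hZ : IsBoundedInProbability P Z) :
    IsBoundedInProbability P fun n ω => Y n ω - Z n ω := by
  intro T hT
  have hhalf := hT.atTop_div_const two_pos
  refine tendsto_of_tendsto_of_tendsto_of_le_of_le tendsto_const_nhds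
    (by simpa using (hY _ hhalf).add (hZ _ hhalf)) (fun _ => zero_le) fun n => ?_
  refine (measure_mono fun ω (hω : T n ≤ ‖Y n ω - Z n ω‖) => ?_).trans (measure_union_le _ _)
  by_contra! hsmall
  simp only [Set.mem_union, Set.mem_ofPred_eq, not_or, not_le] at hsmall
  linarith [norm_sub_le (Y n ω) (Z n ω)]

theorem pi {ι : Type*} [Fintype ι] {Y : ℕ → Ω → ι → E}
    (hY : ∀ i, IsBoundedInProbability P fun n ω => Y n ω i) : IsBoundedInProbability P Y := by
  intro T hT
  refine tendsto_of_tendsto_of_tendsto_of_le_of_le' tendsto_const_nhds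
    (by simpa using tendsto_finsetSum Finset.univ fun i _ => hY i T hT)
    (Eventually.of_forall fun _ => zero_le) ?_
  filter_upwards [hT.eventually_gt_atTop 0] with n hTn
  refine (measure_mono fun ω (hω : T n ≤ ‖Y n ω‖) => ?_).trans (measure_iUnion_fintype_le P _)
  by_contra! hsmall
  simp only [Set.mem_iUnion, Set.mem_ofPred_eq, not_exists, not_le] at hsmall
  exact hω.not_gt ((pi_norm_lt_iff hTn).mpr hsmall)

theorem of_tendstoInDistribution {Ω' F : Type*} [MeasurableSpace Ω'] [IsProbabilityMeasure P]
    {P' : Measure Ω'} [IsProbabilityMeasure P'] [NormedAddCommGroup F] [ProperSpace F]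
    [MeasurableSpace F] [BorelSpace F] {Y : ℕ → Ω → F} {Z : Ω' → F}
    (h : TendstoInDistribution Y atTop Z (fun _ => P) P') :
    IsBoundedInProbability P Y := by
  intro T hT
  rw [ENNReal.tendsto_nhds_zero]
  intro δ hδ
  have : IsProbabilityMeasure (P'.map Z) := Measure.isProbabilityMeasure_map h.aemeasurable_limit
  have htight := isTightMeasureSet_iff_tendsto_measure_norm_gt.mp
    (isTightMeasureSet_singleton (μ := P'.map Z))
  simp only [Set.mem_singleton_iff, iSup_iSup_eq_left] at htight
  obtain ⟨M, hM⟩ := (htight.eventually_lt_const hδ).exists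
  have hclosed : IsClosed {x : F | M + 1 ≤ ‖x‖} := isClosed_le continuous_const continuous_norm
  have hlimsup : limsup (fun n => P.map (Y n) {x : F | M + 1 ≤ ‖x‖}) atTop < δ := by
    refine (ProbabilityMeasure.limsup_measure_closed_le_of_tendsto h.tendsto hclosed).trans_lt ?_
    exact (measure_mono fun x hx => (lt_add_one M).trans_le hx).trans_lt hM
  filter_upwards [eventually_lt_of_limsup_lt hlimsup, hT.eventually_ge_atTop (M + 1)]
    with n hsmall hTn
  rw [Measure.map_apply_of_aemeasurable (h.forall_aemeasurable n) hclosed.measurableSet] at hsmall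
  exact (measure_mono fun ω hω => hTn.trans hω).trans hsmall.le

theorem of_variance_isBigO_one [IsFiniteMeasure P] {Y : ℕ → Ω → ℝ} (hY : ∀ n, MemLp (Y n) 2 P)
    (hmean : ∀ n, P[Y n] = 0) (hvar : (fun n => Var[Y n; P]) =O[atTop] fun _ => (1 : ℝ)) :
    IsBoundedInProbability P Y := by
  intro T hT
  have hT2 : Tendsto (fun n => (T n ^ 2)⁻¹) atTop (𝓝 0) :=
    ((tendsto_pow_atTop two_ne_zero).comp hT).inv_tendsto_atTop
  have hchebyshev : Tendsto (fun n => ENNReal.ofReal (Var[Y n; P] / T n ^ 2)) atTop (𝓝 0) := by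
    have hratio : Tendsto (fun n => Var[Y n; P] * (T n ^ 2)⁻¹) atTop (𝓝 0) :=
      (hvar.mul (Asymptotics.isBigO_refl _ atTop)).trans_tendsto (by simpa using hT2)
    simpa [div_eq_mul_inv] using ENNReal.tendsto_ofReal hratio
  refine tendsto_of_tendsto_of_tendsto_of_le_of_le' tendsto_const_nhds hchebyshev
    (Eventually.of_forall fun _ => zero_le) ?_
  filter_upwards [hT.eventually_gt_atTop 0] with n hTn
  simpa [hmean n] using meas_ge_le_variance_div_sq (hY n) hTn

theorem sqrt_smul_of_div_isBigO_one [NormedSpace ℝ E] {Y : ℕ → Ω → E} {m : ℕ → ℕ}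
    (hY : IsBoundedInProbability P fun n ω => √(m n : ℝ) • Y n ω) (hm : ∀ᶠ n in atTop, 0 < m n)
    (hnm : (fun n : ℕ => (n : ℝ) / m n) =O[atTop] fun _ => (1 : ℝ)) :
    IsBoundedInProbability P fun n ω => √(n : ℝ) • Y n ω := by
  have hsqrt : (fun n : ℕ => √((n : ℝ) / m n)) =O[atTop] fun _ => (1 : ℝ) := by
    simpa using hnm.sqrt (Eventually.of_forall fun _ => zero_le_one)
  refine hY.of_norm_le_mul hsqrt ?_
  filter_upwards [hm] with n hmn ω
  have hmpos : 0 < √(m n : ℝ) := Real.sqrt_pos.mpr (Nat.cast_pos.mpr hmn)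
  simp only [norm_smul, Real.norm_of_nonneg (Real.sqrt_nonneg _)]
  rw [Real.sqrt_div n.cast_nonneg, ← mul_assoc, div_mul_cancel₀ _ hmpos.ne']

theorem mulVec {κ ι : Type*} [Fintype κ] [Fintype ι] {A : ℕ → Matrix κ ι ℝ} {Y : ℕ → Ω → ι → ℝ}
    (hY : IsBoundedInProbability P Y) (hA : ∀ j k, (fun n => A n j k) =O[atTop] fun _ => (1 : ℝ)) :
    IsBoundedInProbability P fun n ω => A n *ᵥ Y n ω := by
  refine .pi fun j => ?_
  have hrow : (fun n => ∑ k, |A n j k|) =O[atTop] fun _ => (1 : ℝ) :=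
    .fun_sum fun k _ => (hA j k).norm_left
  refine hY.of_norm_le_mul hrow (Eventually.of_forall fun n ω => ?_)
  rw [Matrix.mulVec, dotProduct_comm, mul_comm]
  exact abs_dotProduct_le_norm_mul_sum_abs (Y n ω) (A n j)

end IsBoundedInProbability

theorem tendsto_measure_one_of_ae_or {ι : Type*} {l : Filter ι} [IsProbabilityMeasure P]
    {A B : ι → Set Ω} (hAB : ∀ᶠ i in l, ∀ᵐ ω ∂P, ω ∈ A i ∨ ω ∈ B i)
    (hB : Tendsto (fun i => P (B i)) l (𝓝 0)) : Tendsto (fun i => P (A i)) l (𝓝 1) := by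
  have hlower : Tendsto (fun i => 1 - P (B i)) l (𝓝 1) := by
    simpa using ENNReal.Tendsto.sub tendsto_const_nhds hB (Or.inl ENNReal.one_ne_top)
  refine tendsto_of_tendsto_of_tendsto_of_le_of_le' hlower tendsto_const_nhds ?_
    (Eventually.of_forall fun _ => prob_le_one)
  filter_upwards [hAB] with i hi
  rw [tsub_le_iff_right, ← measure_univ (μ := P)]
  exact (measure_mono_ae (hi.mono fun ω hω _ => hω)).trans (measure_union_le _ _)

end BoundedInProbability

section LinearModel

variable {Ω : Type*} [MeasurableSpace Ω] {P : Measure Ω} {p : ℕ}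

/-- Errors satisfying the Gauss–Markov conditions (square integrable, centred, pairwise
uncorrelated), with equality of the variances relaxed to a common bound `v`. -/
structure IsUncorrelatedNoise {ι : Type*} (P : Measure Ω) (v : ℝ) (ξ : ι → Ω → ℝ) : Prop where
  memLp_two : ∀ i, MemLp (ξ i) 2 P
  integral_eq_zero : ∀ i, P[ξ i] = 0
  variance_le : ∀ i, Var[ξ i; P] ≤ v
  covariance_eq_zero : Pairwise fun i k => cov[ξ i, ξ k; P] = 0

namespace IsUncorrelatedNoise

variable {ι : Type*} {v : ℝ} {ξ : ι → Ω → ℝ}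

theorem of_iIndepFun_gaussianReal [IsFiniteMeasure P] {v : ℝ≥0}
    (hlaw : ∀ i, HasLaw (ξ i) (gaussianReal 0 v) P) (hindep : iIndepFun ξ P) :
    IsUncorrelatedNoise P v ξ := by
  have hmem : ∀ i, MemLp (ξ i) 2 P := fun i =>
    ((hlaw i).map_eq.symm ▸ memLp_id_gaussianReal 2 : MemLp id 2 (P.map (ξ i))).comp_of_map
      (hlaw i).aemeasurable
  exact
    { memLp_two := hmem
      integral_eq_zero := fun i => by rw [(hlaw i).integral_eq, integral_id_gaussianReal]
      variance_le := fun i => by rw [(hlaw i).variance_eq, variance_id_gaussianReal]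
      covariance_eq_zero := fun i k hik =>
        (hindep.indepFun hik).covariance_eq_zero (hmem i) (hmem k) }

variable [Fintype ι]

theorem memLp_two_sum_mul (h : IsUncorrelatedNoise P v ξ) (a : ι → ℝ) :
    MemLp (fun ω => ∑ i, a i * ξ i ω) 2 P :=
  memLp_finsetSum _ fun i _ => (h.memLp_two i).const_mul (a i)

theorem integral_sum_mul_eq_zero [IsFiniteMeasure P] (h : IsUncorrelatedNoise P v ξ) (a : ι → ℝ) :
    P[fun ω => ∑ i, a i * ξ i ω] = 0 := by
  rw [integral_finsetSum _ fun i _ => ((h.memLp_two i).const_mul (a i)).integrable one_le_two]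
  refine Finset.sum_eq_zero fun i _ => ?_
  rw [integral_const_mul, h.integral_eq_zero, mul_zero]

theorem variance_sum_mul_le [IsFiniteMeasure P] (h : IsUncorrelatedNoise P v ξ) (a : ι → ℝ) :
    Var[fun ω => ∑ i, a i * ξ i ω; P] ≤ v * ∑ i, a i ^ 2 := by
  rw [variance_fun_sum fun i => (h.memLp_two i).const_mul (a i), Finset.mul_sum]
  refine Finset.sum_le_sum fun i _ => ?_
  have hoffdiag : ∀ k ≠ i, cov[fun ω => a i * ξ i ω, fun ω => a k * ξ k ω; P] = 0 := by
    intro k hki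
    rw [covariance_const_mul_left, covariance_const_mul_right, h.covariance_eq_zero hki.symm,
      mul_zero, mul_zero]
  rw [Finset.sum_eq_single_of_mem i (Finset.mem_univ i) fun k _ hki => hoffdiag k hki,
    covariance_self ((h.memLp_two i).const_mul (a i)).aemeasurable, variance_const_mul, mul_comm]
  exact mul_le_mul_of_nonneg_right (h.variance_le i) (sq_nonneg _)

end IsUncorrelatedNoise

theorem isBoundedInProbability_noise_score [IsFiniteMeasure P] {v : ℝ}
    {X : ∀ n : ℕ, Matrix (Fin n) (Fin p) ℝ} {ε : ∀ n : ℕ, Ω → Fin n → ℝ}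
    (hgram : ∀ j, (fun n => gramMatrix (X n) j j) =O[atTop] fun _ => (1 : ℝ))
    (hε : ∀ n, IsUncorrelatedNoise P v fun i ω => ε n ω i) :
    IsBoundedInProbability P fun n ω => (√(n : ℝ))⁻¹ • ((X n)ᵀ *ᵥ ε n ω) := by
  refine .pi fun j => ?_
  have hcombination : ∀ (n : ℕ) ω, ((√(n : ℝ))⁻¹ • ((X n)ᵀ *ᵥ ε n ω)) j
      = ∑ i, ((√(n : ℝ))⁻¹ * X n i j) * ε n ω i := by
    intro n ω
    simp only [Pi.smul_apply, smul_eq_mul, Matrix.mulVec, dotProduct, Matrix.transpose_apply,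
      Finset.mul_sum, mul_assoc]
  have hweights : ∀ᶠ n : ℕ in atTop,
      ∑ i, ((√(n : ℝ))⁻¹ * X n i j) ^ 2 = gramMatrix (X n) j j := by
    filter_upwards [eventually_gt_atTop 0] with n hn
    simp only [mul_pow, ← Finset.mul_sum]
    rw [sum_sq_eq_mul_gramMatrix_apply_self, inv_pow, Real.sq_sqrt n.cast_nonneg,
      inv_mul_cancel_left₀ (by positivity)]
  simp only [hcombination]
  refine .of_variance_isBigO_one (fun n => (hε n).memLp_two_sum_mul _)
    (fun n => (hε n).integral_sum_mul_eq_zero _) (.trans (.of_bound |v| ?_) (hgram j))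
  filter_upwards [hweights] with n hn
  rw [Real.norm_of_nonneg (variance_nonneg _ _)]
  calc _ ≤ v * gramMatrix (X n) j j := hn ▸ (hε n).variance_sum_mul_le _
    _ ≤ |v| * ‖gramMatrix (X n) j j‖ := (le_abs_self _).trans_eq (abs_mul _ _)

theorem isBoundedInProbability_score [IsFiniteMeasure P] {v : ℝ} {βstar : Fin p → ℝ}
    {X : ∀ n : ℕ, Matrix (Fin n) (Fin p) ℝ} {ε : ∀ n : ℕ, Ω → Fin n → ℝ}
    {b : ℕ → Ω → Fin p → ℝ}
    (hgram : ∀ j k, (fun n => gramMatrix (X n) j k) =O[atTop] fun _ => (1 : ℝ))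
    (hε : ∀ n, IsUncorrelatedNoise P v fun i ω => ε n ω i)
    (hb : IsBoundedInProbability P fun n ω => √(n : ℝ) • (b n ω - βstar)) :
    IsBoundedInProbability P fun n ω =>
      (√(n : ℝ))⁻¹ • ((X n)ᵀ *ᵥ (linearResponse (X n) βstar (ε n ω) - X n *ᵥ b n ω)) := by
  have hrescale : ∀ (n : ℕ) ω,
      (√(n : ℝ))⁻¹ • ((X n)ᵀ *ᵥ (linearResponse (X n) βstar (ε n ω) - X n *ᵥ b n ω))
        = (√(n : ℝ))⁻¹ • ((X n)ᵀ *ᵥ ε n ω) - gramMatrix (X n) *ᵥ (√(n : ℝ) • (b n ω - βstar)) := by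
    intro n ω
    rw [transpose_mulVec_linearResponse_sub, smul_sub, smul_smul, inv_mul_eq_div,
      Real.div_sqrt, Matrix.mulVec_smul]
  simp only [hrescale]
  exact (isBoundedInProbability_noise_score (fun j => hgram j j) hε).sub (hb.mulVec hgram)

theorem tendsto_penalty_gap_div_sqrt_atTop {lam eta : ℕ → ℝ} {ρ₀ : ℝ} (hρ₀ : |ρ₀| < 1)
    (heta : Tendsto (fun n : ℕ => eta n / √(n : ℝ)) atTop atTop)
    (hlam : Tendsto (fun n : ℕ => lam n / eta n) atTop (𝓝 ρ₀)) :
    Tendsto (fun n : ℕ => (eta n - |lam n|) / √(n : ℝ)) atTop atTop := by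
  refine (heta.atTop_mul_pos (sub_pos.mpr hρ₀) (hlam.abs.const_sub 1)).congr' ?_
  filter_upwards [heta.eventually_gt_atTop 0] with n hn
  have hetan : 0 < eta n := pos_of_mul_pos_left hn (inv_nonneg.mpr (Real.sqrt_nonneg _))
  rw [abs_div, abs_of_pos hetan]
  field_simp

theorem ConsistentInvariantSelection.of_tendsto_measure_eq [IsProbabilityMeasure P]
    {βstar : Fin p → ℝ} {βinit βhat : ℕ → Ω → Fin p → ℝ}
    (h : Tendsto (fun n => P {ω | βhat n ω = βinit n ω}) atTop (𝓝 1)) :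
    ConsistentInvariantSelection P βstar βinit βhat :=
  tendsto_of_tendsto_of_tendsto_of_le_of_le h tendsto_const_nhds
    (fun _ => measure_mono fun _ hω j _ => congrFun hω j) fun _ => prob_le_one

theorem mainTheorem8_general [IsProbabilityMeasure P] {v : ℝ} {βstar : Fin p → ℝ}
    {X : ∀ n : ℕ, Matrix (Fin n) (Fin p) ℝ} {ε : ∀ n : ℕ, Ω → Fin n → ℝ}
    {βinit βhat : ℕ → Ω → Fin p → ℝ} {lam eta : ℕ → ℝ}
    (hgram : ∀ j k, (fun n => gramMatrix (X n) j k) =O[atTop] fun _ => (1 : ℝ))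
    (hε : ∀ n, IsUncorrelatedNoise P v fun i ω => ε n ω i)
    (hinit : IsBoundedInProbability P fun n ω => √(n : ℝ) • (βinit n ω - βstar))
    (hgap : Tendsto (fun n : ℕ => (eta n - |lam n|) / √(n : ℝ)) atTop atTop)
    (hβhat : ∀ n : ℕ, ∀ᵐ ω ∂P,
      IsTransferLasso (X n) (linearResponse (X n) βstar (ε n ω)) (βinit n ω)
        (lam n) (eta n) (βhat n ω)) :
    Tendsto (fun n => P {ω | βhat n ω = βinit n ω}) atTop (𝓝 1) := by
  refine tendsto_measure_one_of_ae_or ?_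
    (isBoundedInProbability_score hgram hε hinit _ (hgap.atTop_div_const two_pos))
  filter_upwards [eventually_gt_atTop 0] with n hn
  filter_upwards [hβhat n] with ω hω
  refine or_iff_not_imp_right.mpr fun hscore => hω.eq_init_of_norm_score_lt hn ?_
  have hsqrt : 0 < √(n : ℝ) := Real.sqrt_pos.mpr (Nat.cast_pos.mpr hn)
  change ¬_ ≤ _ at hscore
  rw [not_le, norm_smul, norm_inv, Real.norm_of_nonneg hsqrt.le,
    div_right_comm, inv_mul_eq_div, div_lt_div_iff_of_pos_right hsqrt] at hscore
  linarith

end LinearModel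

theorem mainTheorem8 {Ω : Type*} [MeasurableSpace Ω] (P : Measure Ω) [IsProbabilityMeasure P]
    (p : ℕ) (βstar : Fin p → ℝ) (σ : ℝ≥0)
    -- design matrices: `C_n → C ≻ 0` and `(1/n) max_i ‖x_i‖₂² → 0`
    (X : ∀ n : ℕ, Matrix (Fin n) (Fin p) ℝ) (C : Matrix (Fin p) (Fin p) ℝ)
    (hC : C.PosDef)
    (hgram : Tendsto (fun n => gramMatrix (X n)) atTop (𝓝 C))
    (hrow : Tendsto (fun n => maxRowSqNorm (X n)) atTop (𝓝 0))
    -- for each `n`, the noise has i.i.d. `N(0, σ²)` components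
    (ε : ∀ n : ℕ, Ω → Fin n → ℝ)
    (hεlaw : ∀ (n : ℕ) (i : Fin n), HasLaw (fun ω => ε n ω i) (gaussianReal 0 (σ ^ 2)) P)
    (hεindep : ∀ n : ℕ, iIndepFun (fun (i : Fin n) ω => ε n ω i) P)
    -- source sample size: `n / m → r₀ ∈ [0, ∞)`
    (m : ℕ → ℕ) (hm : ∀ᶠ n in atTop, 0 < m n)
    (r₀ : ℝ) (hr₀ : 0 ≤ r₀)
    (hnm : Tendsto (fun n : ℕ => (n : ℝ) / (m n : ℝ)) atTop (𝓝 r₀))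
    -- initial estimator: independent of the target noise, and `√m (βinit - β*)` converges
    -- in distribution to a probability law `ν`
    (βinit : ℕ → Ω → Fin p → ℝ)
    (hindep : ∀ n : ℕ, IndepFun (βinit n) (ε n) P)
    (ν : Measure (Fin p → ℝ)) [IsProbabilityMeasure ν]
    (hinit : TendstoInDistribution
      (fun (n : ℕ) ω => √(m n : ℝ) • (βinit n ω - βstar)) atTop
      (id : (Fin p → ℝ) → Fin p → ℝ) (fun _ => P) ν)
    (hincons : InconsistentActiveSelection P βstar βinit)
    -- regime (i) of the tuning parameters
    (lam eta : ℕ → ℝ) (ρ₀ : ℝ) (hρ₀ : 0 ≤ ρ₀) (hρ₁ : ρ₀ < 1)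
    (heta : Tendsto (fun n : ℕ => eta n / √(n : ℝ)) atTop atTop)
    (hlam : Tendsto (fun n : ℕ => lam n / eta n) atTop (𝓝 ρ₀))
    -- the Transfer Lasso estimator
    (βhat : ℕ → Ω → Fin p → ℝ)
    (hβhat : ∀ n : ℕ, ∀ᵐ ω ∂P,
      IsTransferLasso (X n) (linearResponse (X n) βstar (ε n ω)) (βinit n ω)
        (lam n) (eta n) (βhat n ω)) :
    ConsistentInvariantSelection P βstar βinit βhat :=
  .of_tendsto_measure_eq <| mainTheorem8_general
    (fun j k => ((hgram.apply_nhds j).apply_nhds k).isBigO_one ℝ)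
    (fun n => .of_iIndepFun_gaussianReal (hεlaw n) (hεindep n))
    (.sqrt_smul_of_div_isBigO_one (.of_tendstoInDistribution hinit) hm (hnm.isBigO_one ℝ))
    (tendsto_penalty_gap_div_sqrt_atTop (abs_lt.mpr ⟨by linarith, hρ₁⟩) heta hlam) hβhat
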